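/- Let $X$ be a reflexive Banach space (real or complex), let $K$ be a nonempty, convex, bounded, closed subset of $X$, and let $F$ be a map defined on $K$ such that $F(K)\subset K$. Assume that there is a Banach space $Y$ (over the same field) such that: (i) $X\subset Y$ with compact immersion, i.e. $X$ is embedded in $Y$ by an injective compact linear map; (ii) whenever a sequence $v_n\in K$ converges weakly in $X$ to some $v\in K$, there is a subsequence $(v_m)$ of $(v_n)$ such that $F(v_m)\to F(v)$ in the norm of $Y$. Then $F$ has a fixed point in $K$, i.e. there is $x\in K$ with $F(x)=x$. -/

import Mathlib

open Filter Topology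

/-- A normed space `E` over `𝕜` is reflexive if the canonical embedding `x ↦ (f ↦ f x)` of `E` into
its topological bidual is surjective. -/
def IsReflexiveSpace (𝕜 : Type*) [RCLike 𝕜] (E : Type*) [NormedAddCommGroup E]
    [NormedSpace 𝕜 E] : Prop :=
  Function.Surjective (NormedSpace.inclusionInDoubleDual 𝕜 E)

/-- The sequence `u` converges to `x` in the weak topology of `E`. -/
def WeaklyConverges (𝕜 : Type*) [RCLike 𝕜] {E : Type*} [NormedAddCommGroup E]
    [NormedSpace 𝕜 E] (u : ℕ → E) (x : E) : Prop :=
  Tendsto (fun n => toWeakSpace 𝕜 E (u n)) atTop (𝓝 (toWeakSpace 𝕜 E x))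

open MeasureTheory Metric

/-! The map `ι ∘ F ∘ ι⁻¹` acts on `ι '' K`, which is convex and norm compact. On it, norm
convergence in `Y` forces weak convergence of preimages in `X`, so (ii) makes this map continuous.
Schauder's theorem gives a fixed point, and injectivity of `ι` returns it to `K`.

Schauder is reduced to Brouwer by a partition of unity on a finite net. Brouwer rests on a volume
argument: `x + t • h x` preserves a ball for small `t`, so the integral of its Jacobian, polynomial
in `t`, stays equal to the volume at `t = 1`, where a map into the sphere would make it zero. -/

theorem exists_weights_det_one_add_smul (n : ℕ) {δ : ℝ} (hδ : 0 < δ) :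
    ∃ (v c : ℕ → ℝ), (∀ i, 0 ≤ v i ∧ v i < δ) ∧ ∑ i ∈ Finset.range (n + 1), c i = 1 ∧
      ∀ A : Matrix (Fin n) (Fin n) ℝ,
        (1 + A).det = ∑ i ∈ Finset.range (n + 1), c i * (1 + v i • A).det := by
  have hv : Set.InjOn (fun i : ℕ => δ / (i + 2)) (Finset.range (n + 1)) := by
    intro i _ j _ hij
    have hij : δ / ((i : ℝ) + 2) = δ / (j + 2) := hij
    have h1 : (i : ℝ) + 2 ≠ 0 := by positivity
    have h2 : (j : ℝ) + 2 ≠ 0 := by positivity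
    rw [div_eq_div_iff h1 h2] at hij
    have := mul_left_cancel₀ hδ.ne' hij
    exact_mod_cast (add_right_cancel this).symm
  refine ⟨fun i => δ / (i + 2), fun i => (Lagrange.basis (Finset.range (n + 1))
    (fun i : ℕ => δ / (i + 2)) i).eval 1, fun i => ⟨by positivity, ?_⟩, ?_, fun A => ?_⟩
  · exact div_lt_self hδ (by have : (0 : ℝ) ≤ i := i.cast_nonneg; linarith)
  · rw [← Polynomial.eval_finsetSum, Lagrange.sum_basis hv (by simp), Polynomial.eval_one]
  -- `det (1 + t • A)` has degree at most `n` in `t`, so `n + 1` nodes recover its value at 1, with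
  -- weights independent of `A`.
  · set p : Polynomial ℝ := ((Polynomial.X : Polynomial ℝ) • A.map Polynomial.C +
      (1 : Matrix (Fin n) (Fin n) ℝ).map Polynomial.C).det with hp
    have heval : ∀ t : ℝ, p.eval t = (1 + t • A).det := by
      intro t
      rw [hp, ← Polynomial.coe_evalRingHom, RingHom.map_det]
      congr 1
      ext i j
      by_cases hij : i = j <;> simp [hij] <;> ring
    have hdeg : p.degree < (Finset.range (n + 1)).card := by
      refine lt_of_le_of_lt Polynomial.degree_le_natDegree ?_
      have := Polynomial.natDegree_det_X_add_C_le A 1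
      rw [Fintype.card_fin] at this
      rw [Finset.card_range]
      exact_mod_cast Nat.lt_succ_of_le this
    have h1 := congrArg (Polynomial.eval 1) (Lagrange.eq_interpolate hv hdeg)
    rw [heval, one_smul, Lagrange.interpolate_apply, Polynomial.eval_finsetSum] at h1
    rw [h1]
    refine Finset.sum_congr rfl fun i _ => ?_
    rw [Polynomial.eval_mul, Polynomial.eval_C, heval, mul_comm]

/-- A segment leaving the ball crosses the sphere, where `k` vanishes, so the constant `L` survives.
-/
theorem LipschitzOnWith.lipschitzWith_indicator_ball
    {E : Type*} [NormedAddCommGroup E] [NormedSpace ℝ E] {L : NNReal} {k : E → E} {R : ℝ}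
    (hk : LipschitzOnWith L k (closedBall 0 R)) (h0 : ∀ x, ‖x‖ = R → k x = 0) :
    LipschitzWith L ((ball (0 : E) R).indicator k) := by
  have hcross : ∀ x ∈ ball (0 : E) R, ∀ y ∉ ball (0 : E) R, dist (k x) 0 ≤ L * dist x y := by
    intro x hx y hy
    rw [mem_ball_zero_iff] at hx hy
    have hc : ContinuousOn (fun s : ℝ => ‖AffineMap.lineMap x y s‖) (Set.Icc 0 1) := by
      fun_prop
    obtain ⟨s, hs, hsR⟩ := intermediate_value_Icc zero_le_one hc
      (show R ∈ Set.Icc _ _ by simpa using ⟨hx.le, not_lt.1 hy⟩)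
    have hsR : ‖AffineMap.lineMap x y s‖ = R := hsR
    rw [← h0 _ hsR]
    refine (hk.dist_le_mul _ (by simpa using hx.le) _ (by simpa using hsR.le)).trans ?_
    rw [dist_left_lineMap, Real.norm_of_nonneg hs.1]
    gcongr
    exact mul_le_of_le_one_left dist_nonneg hs.2
  refine LipschitzWith.of_dist_le_mul fun x y => ?_
  by_cases hx : x ∈ ball (0 : E) R <;> by_cases hy : y ∈ ball (0 : E) R
  · rw [Set.indicator_of_mem hx, Set.indicator_of_mem hy]
    exact hk.dist_le_mul _ (ball_subset_closedBall hx) _ (ball_subset_closedBall hy)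
  · rw [Set.indicator_of_mem hx, Set.indicator_of_notMem hy]
    exact hcross x hx y hy
  · rw [Set.indicator_of_notMem hx, Set.indicator_of_mem hy, dist_comm, dist_comm x]
    exact hcross y hy x hx
  · rw [Set.indicator_of_notMem hx, Set.indicator_of_notMem hy, dist_self]
    positivity

section Brouwer

variable {E : Type*} [NormedAddCommGroup E] [InnerProductSpace ℝ E] [FiniteDimensional ℝ E]

theorem exists_weights_clm_det_one_add_smul {δ : ℝ} (hδ : 0 < δ) :
    ∃ (s : Finset ℕ) (v c : ℕ → ℝ), (∀ i, 0 ≤ v i ∧ v i < δ) ∧ ∑ i ∈ s, c i = 1 ∧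
      ∀ A : E →L[ℝ] E,
        (1 + A).det = ∑ i ∈ s, c i * (1 + v i • A).det := by
  obtain ⟨v, c, hv, hc, h⟩ := exists_weights_det_one_add_smul (Module.finrank ℝ E) hδ
  refine ⟨_, v, c, hv, hc, fun A => ?_⟩
  let b := Module.finBasis ℝ E
  have key : ∀ t : ℝ, (1 + t • A).det = (1 + t • LinearMap.toMatrix b b (A : E →ₗ[ℝ] E)).det := by
    intro t
    rw [ContinuousLinearMap.det, ← LinearMap.det_toMatrix b]
    congr 1
    have : ((1 + t • A : E →L[ℝ] E) : E →ₗ[ℝ] E) = 1 + t • (A : E →ₗ[ℝ] E) := rfl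
    rw [this, map_add, map_smul, LinearMap.toMatrix_one]
  have h1 := key 1
  rw [one_smul, one_smul] at h1
  rw [h1, h]
  exact Finset.sum_congr rfl fun i _ => by rw [key]

theorem bijective_add_smul_of_lipschitzWith {L : NNReal} {h : E → E} (hL : LipschitzWith L h)
    {t : ℝ} (ht : 0 ≤ t) (htL : t * L < 1) : Function.Bijective fun x => x + t • h x := by
  constructor
  · intro x y hxy
    have hxy : x + t • h x = y + t • h y := hxy
    have h1 : x - y = t • (h y - h x) := by
      rw [smul_sub, sub_eq_sub_iff_add_eq_add, hxy, add_comm]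
    have h2 : ‖x - y‖ ≤ t * L * ‖x - y‖ := by
      calc ‖x - y‖ = t * ‖h y - h x‖ := by
            conv_lhs => rw [h1, norm_smul, Real.norm_of_nonneg ht]
        _ ≤ t * (L * ‖y - x‖) := by gcongr; exact hL.norm_sub_le y x
        _ = t * L * ‖x - y‖ := by rw [norm_sub_rev]; ring
    have h3 : ‖x - y‖ = 0 := by nlinarith [norm_nonneg (x - y)]
    exact sub_eq_zero.1 (norm_eq_zero.1 h3)
  · intro y
    have hc : ContractingWith (Real.toNNReal t * L) fun x => y - t • h x := by
      constructor
      · rw [← NNReal.coe_lt_coe]; simpa [ht] using htL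
      · refine LipschitzWith.of_dist_le_mul fun a b => ?_
        rw [dist_eq_norm, dist_eq_norm, NNReal.coe_mul, Real.coe_toNNReal t ht]
        calc ‖y - t • h a - (y - t • h b)‖ = ‖t • (h b - h a)‖ := by
              congr 1; rw [smul_sub]; abel
          _ = t * ‖h b - h a‖ := by rw [norm_smul, Real.norm_of_nonneg ht]
          _ ≤ t * (L * ‖b - a‖) := by gcongr; exact hL.norm_sub_le b a
          _ = t * L * ‖a - b‖ := by rw [norm_sub_rev]; ring
    refine ⟨hc.fixedPoint, ?_⟩
    have := hc.fixedPoint_isFixedPt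
    simp only [Function.IsFixedPt] at this
    rw [sub_eq_iff_eq_add] at this
    exact this.symm

/-- Differentiating the constant `‖f‖ ^ 2` shows that the range of `f'` is orthogonal to the nonzero
vector `f x`. -/
theorem det_eq_zero_of_norm_eq_on_ball {f : E → E} {f' : E →L[ℝ] E} {R : ℝ} (hR : 0 < R) {U : Set E}
    (hU : IsOpen U) {x : E} (hx : x ∈ U) (hf : HasFDerivAt f f' x) (hs : ∀ y ∈ U, ‖f y‖ = R) :
    f'.det = 0 := by
  have h1 : HasFDerivAt (fun y => ‖f y‖ ^ 2) (2 • (innerSL ℝ (f x)).comp f') x := hf.norm_sq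
  have h2 : HasFDerivAt (fun y => ‖f y‖ ^ 2) (0 : E →L[ℝ] ℝ) x := by
    refine (hasFDerivAt_const (R ^ 2) x).congr_of_eventuallyEq ?_
    filter_upwards [hU.mem_nhds hx] with y hy
    rw [hs y hy]
  have h3 := h1.unique h2
  by_contra hdet
  have hsurj : Function.Surjective (f' : E →ₗ[ℝ] E) :=
    (LinearMap.equivOfDetNeZero _ hdet).surjective
  obtain ⟨z, hz⟩ := hsurj (f x)
  have h4 := congrArg (fun g : E →L[ℝ] ℝ => g z) h3
  have hz' : f' z = f x := hz
  simp [hz'] at h4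
  have := hs x hx
  rw [h4, norm_zero] at this
  exact hR.ne this

theorem not_norm_add_eq_of_lipschitzWith {L : NNReal} {h : E → E} (hL : LipschitzWith L h)
    {R : ℝ} (hR : 0 < R) (h0 : ∀ x, R ≤ ‖x‖ → h x = 0)
    (hd : ∀ x ∈ ball (0 : E) R, DifferentiableAt ℝ h x) :
    ¬ ∀ x ∈ ball (0 : E) R, ‖x + h x‖ = R := by
  intro hs
  borelize E
  let μ : Measure E := volume
  have hdet : ∀ᶠ B in 𝓝 (0 : E →L[ℝ] E), 0 < (1 + B).det := by
    have hc : ContinuousAt (fun B : E →L[ℝ] E => (1 + B).det) 0 :=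
      (ContinuousLinearMap.continuous_det.comp (continuous_const.add continuous_id)).continuousAt
    refine hc.eventually (lt_mem_nhds ?_)
    change 0 < LinearMap.det ((1 + 0 : E →L[ℝ] E) : E →ₗ[ℝ] E)
    rw [add_zero, ContinuousLinearMap.toLinearMap_one, map_one]
    exact one_pos
  obtain ⟨δ, hδ, hδdet⟩ := Metric.eventually_nhds_iff.1 hdet
  have hL1 : (0 : ℝ) < L + 1 := by positivity
  -- The bound on the nodes gives both `v i * L < 1`, for bijectivity, and `v i * L < δ`, for a
  -- positive Jacobian.
  obtain ⟨s, v, c, hv, hc, hcomb⟩ := exists_weights_clm_det_one_add_smul (E := E)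
    (δ := min δ 1 / (L + 1)) (by positivity)
  have hvL : ∀ i, v i * L < min δ 1 := by
    intro i
    have := (hv i).2
    rw [lt_div_iff₀ hL1] at this
    nlinarith [(hv i).1]
  have himg : ∀ i, (fun x => x + v i • h x) '' ball 0 R = ball 0 R := by
    intro i
    have hbij := bijective_add_smul_of_lipschitzWith hL (hv i).1
      ((hvL i).trans_le (min_le_right _ _))
    -- The bijection is the identity off the ball, hence maps the ball onto itself.
    have hcompl : (fun x => x + v i • h x) '' (ball 0 R)ᶜ = (ball 0 R)ᶜ := by
      conv_rhs => rw [← Set.image_id (ball (0 : E) R)ᶜ]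
      refine Set.image_congr fun x hx => ?_
      rw [h0 x (by simpa using hx)]
      simp
    rw [Set.image_compl_eq hbij] at hcompl
    exact compl_injective hcompl
  have hder : ∀ i, ∀ x ∈ ball (0 : E) R, HasFDerivWithinAt (fun x => x + v i • h x)
      (1 + v i • fderiv ℝ h x) (ball 0 R) x := fun i x hx =>
    ((hasFDerivAt_id x).add ((hd x hx).hasFDerivAt.const_smul (v i))).hasFDerivWithinAt
  have hinj : ∀ i, Set.InjOn (fun x => x + v i • h x) (ball 0 R) := fun i =>
    (bijective_add_smul_of_lipschitzWith hL (hv i).1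
      ((hvL i).trans_le (min_le_right _ _))).injective.injOn
  have hpos : ∀ i, ∀ x ∈ ball (0 : E) R, |(1 + v i • fderiv ℝ h x).det| • (1 : ℝ) =
      (1 + v i • fderiv ℝ h x).det := by
    intro i x hx
    rw [smul_eq_mul, mul_one, abs_of_pos]
    refine hδdet ?_
    rw [dist_zero_right, norm_smul, Real.norm_of_nonneg (hv i).1]
    calc v i * ‖fderiv ℝ h x‖ ≤ v i * L := by
          gcongr
          · exact (hv i).1
          · exact norm_fderiv_le_of_lipschitz ℝ hL
      _ < δ := (hvL i).trans_le (min_le_left _ _)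
  have hint : ∀ i, IntegrableOn (fun x => (1 + v i • fderiv ℝ h x).det) (ball 0 R) μ := by
    intro i
    have := (integrableOn_image_iff_integrableOn_abs_det_fderiv_smul μ measurableSet_ball
      (hder i) (hinj i) (fun _ => (1 : ℝ))).1 (by
        rw [himg i]; exact integrableOn_const measure_ball_lt_top.ne)
    exact this.congr_fun (hpos i) measurableSet_ball
  have hval : ∀ i, ∫ x in ball 0 R, (1 + v i • fderiv ℝ h x).det ∂μ = μ.real (ball 0 R) := by
    intro i
    have := integral_image_eq_integral_abs_det_fderiv_smul μ measurableSet_ball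
      (hder i) (hinj i) (fun _ => (1 : ℝ))
    rw [himg i, setIntegral_congr_fun measurableSet_ball (hpos i)] at this
    rw [← this]
    simp
  have hzero : ∀ x ∈ ball (0 : E) R, (1 + fderiv ℝ h x).det = 0 := fun x hx =>
    det_eq_zero_of_norm_eq_on_ball hR isOpen_ball hx
      ((hasFDerivAt_id x).add (hd x hx).hasFDerivAt) hs
  have hfin : ∫ x in ball (0 : E) R, (1 + fderiv ℝ h x).det ∂μ = μ.real (ball 0 R) := by
    rw [funext fun x => hcomb (fderiv ℝ h x), integral_finsetSum _ fun i _ => (hint i).const_mul _]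
    simp_rw [integral_const_mul, hval]
    rw [← Finset.sum_mul, hc, one_mul]
  rw [setIntegral_congr_fun measurableSet_ball hzero] at hfin
  simp only [integral_zero] at hfin
  have : 0 < μ.real (ball (0 : E) R) :=
    ENNReal.toReal_pos (measure_ball_pos _ _ hR).ne' measure_ball_lt_top.ne
  linarith

/-- A form of **Brouwer's fixed point theorem**. -/
theorem Continuous.exists_fixedPoint_of_norm_le {g : E → E} (hg : Continuous g) {M : ℝ}
    (hM : ∀ x, ‖g x‖ ≤ M) : ∃ x, g x = x := by
  by_contra! hfix
  have hM0 : 0 ≤ M := (norm_nonneg _).trans (hM 0)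
  -- The cutoff gives `g` bounded support without creating fixed points: beyond radius `M`, `‖χ x •
  -- g x‖ ≤ M < ‖x‖`.
  let χ : E → ℝ := fun x => max 0 (min 1 (M + 1 - ‖x‖))
  have hχ : Continuous χ := by fun_prop
  let u : E → E := fun x => χ x • g x
  have hu : Continuous u := hχ.smul hg
  have hune : ∀ x, 0 < ‖x - u x‖ := by
    intro x
    rw [norm_pos_iff, sub_ne_zero]
    intro hx
    rcases le_or_gt ‖x‖ M with h | h
    · have : χ x = 1 := by
        change max 0 (min 1 (M + 1 - ‖x‖)) = 1
        rw [min_eq_left (by linarith), max_eq_right zero_le_one]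
      simp only [u, this, one_smul] at hx
      exact hfix x hx.symm
    · have h1 : ‖u x‖ ≤ M := by
        have hχ0 : 0 ≤ χ x := le_max_left _ _
        have hχ1 : χ x ≤ 1 := max_le zero_le_one (min_le_left _ _)
        calc ‖u x‖ = χ x * ‖g x‖ := by rw [norm_smul, Real.norm_of_nonneg hχ0]
          _ ≤ 1 * M := mul_le_mul hχ1 (hM x) (norm_nonneg _) zero_le_one
          _ = M := one_mul M
      rw [← hx] at h1
      linarith
  obtain ⟨v, hv, hvu, hsupp⟩ := hu.exists_contDiff_approx 1 (ε := fun x => ‖x - u x‖)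
    (by fun_prop) hune
  set R : ℝ := M + 1 with hR
  have hRpos : 0 < R := by positivity
  have hv0 : ∀ x, R ≤ ‖x‖ → v x = 0 := by
    intro x hx
    by_contra hne
    refine hsupp hne ?_
    change max 0 (min 1 (M + 1 - ‖x‖)) • g x = 0
    rw [max_eq_left ((min_le_right _ _).trans (by linarith)), zero_smul]
  let w : E → E := fun x => x - v x
  have hw : ContDiff ℝ 1 w := contDiff_id.sub hv
  have hwne : ∀ x, w x ≠ 0 := by
    intro x hx
    have h1 := hvu x
    rw [← sub_eq_zero.1 hx, dist_eq_norm] at h1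
    exact lt_irrefl _ h1
  -- `x + k x` is `w x` rescaled to norm `R`; on the sphere `w x = x`, so `k` vanishes there.
  let k : E → E := fun x => (R / ‖w x‖) • w x - x
  have hk : ContDiff ℝ 1 k :=
    ((contDiff_const.div (hw.norm ℝ hwne) fun x => norm_ne_zero_iff.2 (hwne x)).smul hw).sub
      contDiff_id
  obtain ⟨L, hL⟩ := hk.contDiffOn.exists_lipschitzOnWith one_ne_zero
    (convex_closedBall (0 : E) R) (isCompact_closedBall 0 R)
  have hk0 : ∀ x, ‖x‖ = R → k x = 0 := by
    intro x hx
    simp only [k, w, hv0 x hx.ge, sub_zero, hx, div_self hRpos.ne', one_smul, sub_self]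
  refine not_norm_add_eq_of_lipschitzWith (hL.lipschitzWith_indicator_ball hk0) hRpos
    (fun x hx => Set.indicator_of_notMem (by simpa using hx) _) (fun x hx => ?_) fun x hx => ?_
  · refine (hk.differentiable one_ne_zero x).congr_of_eventuallyEq ?_
    filter_upwards [isOpen_ball.mem_nhds hx] with y hy
    exact Set.indicator_of_mem hy _
  · rw [Set.indicator_of_mem hx]
    simp only [k, add_sub_cancel]
    rw [norm_smul, norm_div, norm_norm, Real.norm_of_nonneg hRpos.le,
      div_mul_cancel₀ _ (norm_ne_zero_iff.2 (hwne x))]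

end Brouwer

section Schauder

variable {V : Type*} [NormedAddCommGroup V] [NormedSpace ℝ V]

/-- The point `y₀` absorbs the missing weight `1 - ∑ i, a i`. -/
theorem Convex.add_sum_smul_sub_mem {ι : Type*} [Fintype ι] {C : Set V} (hC : Convex ℝ C)
    {y₀ : V} (hy₀ : y₀ ∈ C) {y : ι → V} (hy : ∀ i, y i ∈ C) {a : ι → ℝ} (ha : ∀ i, 0 ≤ a i)
    (ha1 : ∑ i, a i ≤ 1) : y₀ + ∑ i, a i • (y i - y₀) ∈ C := by
  have h := hC.sum_mem (t := Finset.univ) (w := fun o : Option ι => o.elim (1 - ∑ i, a i) a)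
    (z := fun o : Option ι => o.elim y₀ y) (by rintro (_ | i) _ <;> simp [ha, ha1])
    (by simp [Fintype.sum_option]) (by rintro (_ | i) _ <;> simp [hy₀, hy])
  simp only [Fintype.sum_option, Option.elim_none, Option.elim_some] at h
  convert h using 1
  simp only [smul_sub, Finset.sum_sub_distrib, ← Finset.sum_smul, sub_smul, one_smul]
  abel

theorem IsCompact.exists_dist_le_of_continuous {C : Set V} (hC : IsCompact C) (hconv : Convex ℝ C)
    (hne : C.Nonempty) {G : C → C} (hG : Continuous G) {ε : ℝ} (hε : 0 < ε) :
    ∃ x, dist (G x) x ≤ ε := by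
  obtain ⟨y₀, hy₀⟩ := hne
  have : CompactSpace C := isCompact_iff_compactSpace.1 hC
  obtain ⟨t, htC, htfin, hcover⟩ := hC.finite_cover_balls hε
  have : Fintype t := htfin.fintype
  let β : V → t → ℝ := fun y i => max 0 (ε - dist y i)
  have hβ0 : ∀ y i, 0 ≤ β y i := fun y i => le_max_left _ _
  have hβc : ∀ i, Continuous fun y => β y i := fun i => by fun_prop
  have hβpos : ∀ y ∈ C, 0 < ∑ i, β y i := by
    intro y hy
    obtain ⟨z, hz, hyz⟩ := Set.mem_iUnion₂.1 (hcover hy)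
    rw [mem_ball] at hyz
    exact Finset.sum_pos' (fun i _ => hβ0 y i)
      ⟨⟨z, hz⟩, Finset.mem_univ _, lt_max_of_lt_right (sub_pos.2 hyz)⟩
  -- Truncated weights make `Q` defined on the whole space, as Brouwer is used here; on the standard
  -- simplex `a s = s`.
  let a : EuclideanSpace ℝ t → t → ℝ := fun s i => max 0 (s i) / max 1 (∑ j, max 0 (s j))
  have ha0 : ∀ s i, 0 ≤ a s i := fun s i => by positivity
  have ha1 : ∀ s, ∑ i, a s i ≤ 1 := by
    intro s
    rw [← Finset.sum_div]
    exact div_le_one_of_le₀ (le_max_right _ _) (by positivity)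
  have hac : ∀ i, Continuous fun s => a s i := by
    intro i
    refine Continuous.div (by fun_prop) (by fun_prop) fun s => ?_
    positivity
  let Q : EuclideanSpace ℝ t → C := fun s => ⟨y₀ + ∑ i, a s i • ((i : V) - y₀),
    hconv.add_sum_smul_sub_mem hy₀ (fun i => htC i.2) (ha0 s) (ha1 s)⟩
  have hQ : Continuous Q := by
    refine Continuous.subtype_mk ?_ _
    exact continuous_const.add
      (continuous_finsetSum _ fun i _ => (hac i).smul continuous_const)
  let lam : C → EuclideanSpace ℝ t := fun y => WithLp.toLp 2 fun i => β y i / ∑ j, β y j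
  have hlam : Continuous lam := by
    refine (PiLp.continuous_toLp 2 _).comp (continuous_pi fun i => ?_)
    refine Continuous.div ((hβc i).comp continuous_subtype_val) ?_ fun y => (hβpos y y.2).ne'
    exact continuous_finsetSum _ fun j _ => (hβc j).comp continuous_subtype_val
  obtain ⟨M, hM⟩ := isBounded_iff_forall_norm_le.1 (isCompact_range hlam).isBounded
  obtain ⟨s, hs⟩ := ((hlam.comp hG).comp hQ).exists_fixedPoint_of_norm_le
    fun x => hM _ ⟨_, rfl⟩
  refine ⟨Q s, ?_⟩
  set y : C := G (Q s) with hy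
  have hsi : ∀ i, s i = β y i / ∑ j, β y j := by
    intro i
    conv_lhs => rw [← hs]
    rfl
  have hs0 : ∀ i, 0 ≤ s i := fun i => by
    rw [hsi]; exact div_nonneg (hβ0 _ _) (hβpos y y.2).le
  have hs1 : ∑ i, s i = 1 := by
    simp_rw [hsi]
    rw [← Finset.sum_div, div_self (hβpos y y.2).ne']
  have hasi : ∀ i, a s i = s i := by
    intro i
    simp only [a]
    simp_rw [max_eq_right (hs0 _)]
    rw [hs1, max_self, div_one]
  have hQs : (Q s : V) - y = ∑ i, s i • ((i : V) - y) := by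
    simp only [Q, hasi, smul_sub, Finset.sum_sub_distrib, ← Finset.sum_smul, hs1, one_smul]
    abel
  rw [dist_comm, Subtype.dist_eq, dist_eq_norm, hQs]
  calc ‖∑ i, s i • ((i : V) - y)‖ ≤ ∑ i, s i * ε := by
        refine norm_sum_le_of_le _ fun i _ => ?_
        rw [norm_smul, Real.norm_of_nonneg (hs0 i)]
        -- Only net points within `ε` of `y` carry weight.
        rcases le_or_gt ε (dist (y : V) i) with h | h
        · have : s i = 0 := by
            rw [hsi]
            simp only [β]
            rw [max_eq_left (sub_nonpos.2 h), zero_div]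
          simp [this]
        · rw [dist_comm, dist_eq_norm] at h
          exact mul_le_mul_of_nonneg_left h.le (hs0 i)
    _ = ε := by rw [← Finset.sum_mul, hs1, one_mul]

/-- **Schauder's fixed point theorem**. -/
theorem IsCompact.exists_fixedPoint_of_convex {C : Set V} (hC : IsCompact C) (hconv : Convex ℝ C)
    (hne : C.Nonempty) {G : C → C} (hG : Continuous G) : ∃ x, G x = x := by
  have : CompactSpace C := isCompact_iff_compactSpace.1 hC
  have : Nonempty C := hne.to_subtype
  obtain ⟨x, hx⟩ := (hG.dist continuous_id).exists_forall_le_of_hasCompactSupport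
    (HasCompactSupport.of_compactSpace _)
  refine ⟨x, by_contra fun hne' => ?_⟩
  have hpos : 0 < dist (G x) x := dist_pos.2 hne'
  obtain ⟨z, hz⟩ := hC.exists_dist_le_of_continuous hconv hne hG (half_pos hpos)
  have := hx z
  simp only [id] at this
  linarith

end Schauder

/-- Closed convex sets are weakly closed; Banach–Alaoglu in the bidual, identified with `X` by
reflexivity, gives compactness. -/
theorem IsReflexiveSpace.isCompact_toWeakSpace_image {𝕜 : Type*} [RCLike 𝕜] {X : Type*}
    [NormedAddCommGroup X] [NormedSpace 𝕜 X] [NormedSpace ℝ X] [IsScalarTower ℝ 𝕜 X]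
    (hX : IsReflexiveSpace 𝕜 X) {K : Set X} (hconv : Convex ℝ K)
    (hbdd : Bornology.IsBounded K) (hclosed : IsClosed K) :
    IsCompact (toWeakSpace 𝕜 X '' K) := by
  have hcl : closure (toWeakSpace 𝕜 X '' K) = toWeakSpace 𝕜 X '' K := by
    rw [← hconv.toWeakSpace_closure 𝕜, hclosed.closure_eq]
  rw [← hcl]
  refine NormedSpace.isCompact_closure_of_isBounded 𝕜 X _ ?_ fun φ _ => ?_
  · rwa [Set.preimage_image_eq _ (toWeakSpace 𝕜 X).injective]
  · obtain ⟨x, hx⟩ := hX (WeakDual.toStrongDual φ)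
    exact ⟨toWeakSpace 𝕜 X x, congrArg StrongDual.toWeakDual hx⟩

/-- The image is weakly compact, hence norm closed; compactness of `T` makes its closure compact. -/
theorem IsCompactOperator.isCompact_image_of_isCompact_toWeakSpace_image {𝕜 : Type*} [RCLike 𝕜]
    {X : Type*} [NormedAddCommGroup X] [NormedSpace 𝕜 X] {Y : Type*} [NormedAddCommGroup Y]
    [NormedSpace 𝕜 Y] {T : X →L[𝕜] Y} (hT : IsCompactOperator T) {K : Set X}
    (hbdd : Bornology.IsBounded K) (hK : IsCompact (toWeakSpace 𝕜 X '' K)) :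
    IsCompact (T '' K) := by
  have himg : WeakSpace.map T '' (toWeakSpace 𝕜 X '' K) = toWeakSpace 𝕜 Y '' (T '' K) := by
    rw [Set.image_image, Set.image_image]; rfl
  have hclosed : IsClosed (T '' K) := by
    have h := (hK.image (WeakSpace.map T).continuous).isClosed
    rw [himg] at h
    have := h.preimage (toWeakSpaceCLM 𝕜 Y).continuous
    rwa [show ⇑(toWeakSpaceCLM 𝕜 Y) = toWeakSpace 𝕜 Y from rfl,
      Set.preimage_image_eq _ (toWeakSpace 𝕜 Y).injective] at this
  rw [← hclosed.closure_eq]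
  exact hT.isCompact_closure_image_of_bounded (f := (T : X →ₗ[𝕜] Y)) hbdd

/-- A continuous injection from a compact space to a Hausdorff one is an embedding; this applies to
`T` on `K`, with weak topologies on both sides. -/
theorem WeaklyConverges.of_tendsto_map {𝕜 : Type*} [RCLike 𝕜]
    {X : Type*} [NormedAddCommGroup X] [NormedSpace 𝕜 X] {Y : Type*} [NormedAddCommGroup Y]
    [NormedSpace 𝕜 Y] {T : X →L[𝕜] Y} (hT : Function.Injective T) {K : Set X}
    (hK : IsCompact (toWeakSpace 𝕜 X '' K)) {u : ℕ → X} (hu : ∀ n, u n ∈ K) {x : X} (hx : x ∈ K)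
    (h : Tendsto (fun n => T (u n)) atTop (𝓝 (T x))) : WeaklyConverges 𝕜 u x := by
  have : CompactSpace (toWeakSpace 𝕜 X '' K) := isCompact_iff_compactSpace.1 hK
  let g : toWeakSpace 𝕜 X '' K → WeakSpace 𝕜 Y := fun z => WeakSpace.map T z
  have hg : Continuous g := (WeakSpace.map T).continuous.comp continuous_subtype_val
  have hginj : Function.Injective g := fun a b hab => Subtype.ext (hT hab)
  have hemb := (hg.isClosedEmbedding hginj).isInducing
  have h1 : Tendsto (fun n => (⟨toWeakSpace 𝕜 X (u n), u n, hu n, rfl⟩ : toWeakSpace 𝕜 X '' K))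
      atTop (𝓝 ⟨toWeakSpace 𝕜 X x, x, hx, rfl⟩) := by
    rw [hemb.tendsto_nhds_iff]
    exact ((toWeakSpaceCLM 𝕜 Y).continuous.tendsto (T x)).comp h
  exact (continuous_subtype_val.tendsto _).comp h1

theorem theorem3p2
    {𝕜 : Type*} [RCLike 𝕜]
    {X : Type*} [NormedAddCommGroup X] [NormedSpace 𝕜 X] [NormedSpace ℝ X]
    [IsScalarTower ℝ 𝕜 X] [CompleteSpace X]
    (hX : IsReflexiveSpace 𝕜 X)
    (K : Set X) (hK_nonempty : K.Nonempty) (hK_convex : Convex ℝ K)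
    (hK_bounded : Bornology.IsBounded K) (hK_closed : IsClosed K)
    (F : K → X) (hF : Set.range F ⊆ K)
    {Y : Type*} [NormedAddCommGroup Y] [NormedSpace 𝕜 Y] [CompleteSpace Y]
    (ι : X →L[𝕜] Y) (hι_injective : Function.Injective ι) (hι_compact : IsCompactOperator ι)
    (hF_weak : ∀ (v : ℕ → K) (w : K), WeaklyConverges 𝕜 (fun n => (v n : X)) (w : X) →
      ∃ φ : ℕ → ℕ, StrictMono φ ∧
        Tendsto (fun m => ι (F (v (φ m)))) atTop (𝓝 (ι (F w)))) :
    ∃ x : K, F x = (x : X) := by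
  let _ : NormedSpace ℝ Y := NormedSpace.restrictScalars ℝ 𝕜 Y
  have : IsScalarTower ℝ 𝕜 Y := RestrictScalars.isScalarTower ℝ 𝕜 Y
  have hKw := hX.isCompact_toWeakSpace_image hK_convex hK_bounded hK_closed
  have hC := hι_compact.isCompact_image_of_isCompact_toWeakSpace_image hK_bounded hKw
  have hCconv : Convex ℝ (ι '' K) :=
    hK_convex.linear_image ((ι : X →ₗ[𝕜] Y).restrictScalars ℝ)
  have hpre : ∀ c : ι '' K, ∃ x : K, ι x = c := fun ⟨_, x, hx, h⟩ => ⟨⟨x, hx⟩, h⟩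
  choose σ hσ using hpre
  let G : ι '' K → ι '' K := fun c => ⟨ι (F (σ c)), F (σ c), hF ⟨_, rfl⟩, rfl⟩
  have hG : Continuous G := by
    -- Convergence along a further subsequence of every subsequence suffices, which is what (ii)
    -- provides.
    refine continuous_iff_seqContinuous.2 fun u c hu => tendsto_of_subseq_tendsto fun ns hns => ?_
    have hconv : Tendsto (fun n => ι (σ (u (ns n)))) atTop (𝓝 (ι (σ c))) := by
      simp_rw [hσ]
      exact (continuous_subtype_val.tendsto c).comp (hu.comp hns)
    obtain ⟨φ, -, hφ⟩ := hF_weak (fun n => σ (u (ns n))) (σ c)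
      (.of_tendsto_map hι_injective hKw (fun n => (σ _).2) (σ c).2 hconv)
    exact ⟨φ, tendsto_subtype_rng.2 hφ⟩
  obtain ⟨c, hc⟩ := hC.exists_fixedPoint_of_convex hCconv (hK_nonempty.image ι) hG
  exact ⟨σ c, hι_injective ((congrArg Subtype.val hc).trans (hσ c).symm)⟩
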